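/- Let $q$ be an odd prime power, let $r\ge 3$, and let $\alpha\in \mathrm{GF}(q^2)\setminus\{0\}$ and $\beta\in \mathrm{GF}(q^2)\setminus \mathrm{GF}(q)$ be such that either $r$ is odd and $4\alpha^{q+1}+(\beta^q-\beta)^2\ne 0$, or $r$ is even and $4\alpha^{q+1}+(\beta^q-\beta)^2$ is a non-square in $\mathrm{GF}(q)$. Let $\mathcal B$ be the set of $\mathrm{GF}(q^2)$-rational points of the projective hypersurface in $\mathrm{PG}(r,q^2)$ (homogeneous coordinates $X_0,\dots,X_r$, with $x_i=X_i/X_0$) which is the homogenization, of degree $2q$, of the affine equation $$x_r^q-x_r+\alpha^q(x_1^{2q}+\dots+x_{r-1}^{2q})-\alpha(x_1^2+\dots+x_{r-1}^2)=(\beta^q-\beta)(x_1^{q+1}+\dots+x_{r-1}^{q+1}).$$ Let $N=|\mathcal B|$ and $m=N-1$. Enumerate the points of $\mathcal B$ in any order as $P_0,P_1,\dots,P_m$, choose for each $P_i$ any representative vector in $\mathrm{GF}(q^2)^{r+1}$, and let $C=\mathcal C(\mathcal B)$ be the linear code of length $N$ over $\mathrm{GF}(q^2)$ spanned by the rows of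 the matrix whose columns are these vectors. Let $C^\perp$ be its dual code and let $H=(g_0,g_1,\dots,g_m)$ be any generator matrix of $C^\perp$, i.e. a matrix whose rows form a basis of $C^\perp$. In the secret sharing scheme based on $C^\perp$ there are $m$ participants, identified with the points $P_1,\dots,P_m$; a vector $u$ over $\mathrm{GF}(q^2)$ yields the secret $u g_0$, and the participant $P_i$ receives the share $u g_i$ ($1\le i\le m$). A set of participants is an access set if the shares of its members determine the secret, and it is a minimal access set if moreover none of its proper subsets is an access set. Then: 1. the number of participants is $$m=\begin{cases} q^{2r-1}+q^{r-1}+\dfrac{q^{2(r-1)}-q^2}{q^2-1}, & r \text{ odd},\\[2mm] q^{2r-1}+\dfrac{q^{2(r-1)}-q^2}{q^2-1}, & r\text{ even};\end{cases}$$ 2. there are exactly $q^{2r}$ minimal access sets; 3. each participant $P_i$, $1\le i\le m$, belongs to exactly $(q^2-1)q^{2(r-1)}$ of the minimal access sets. In particular the scheme is democratic: all participants belong to the same number of minimal access sets, whatever the choice of the point $P_0$. -/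

import Mathlib

/-- The homogenization, of degree `2 q`, of the affine equation
`x_r^q - x_r + α^q (x_1^{2q} + ⋯ + x_{r-1}^{2q}) - α (x_1^2 + ⋯ + x_{r-1}^2)
  = (β^q - β) (x_1^{q+1} + ⋯ + x_{r-1}^{q+1})`,
where `x_i = X_i / X_0`, as left-hand side minus right-hand side, evaluated at the vector
`X = (X_0, …, X_r)`. -/
def hypersurfaceForm {K : Type*} [Field K] (q r : ℕ) (α β : K) (X : Fin (r + 1) → K) : K :=
  X (Fin.last r) ^ q * X 0 ^ q - X (Fin.last r) * X 0 ^ (2 * q - 1)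
    + α ^ q * (∑ i ∈ Finset.Ioo 0 (Fin.last r), X i ^ (2 * q))
    - α * (∑ i ∈ Finset.Ioo 0 (Fin.last r), X i ^ 2) * X 0 ^ (2 * q - 2)
    - (β ^ q - β) * (∑ i ∈ Finset.Ioo 0 (Fin.last r), X i ^ (q + 1)) * X 0 ^ (q - 1)

/-- The form is homogeneous of degree `2 q`. -/
theorem hypersurfaceForm_smul {K : Type*} [Field K] {q : ℕ} (hq : 1 ≤ q) (r : ℕ) (α β c : K)
    (X : Fin (r + 1) → K) :
    hypersurfaceForm q r α β (c • X) = c ^ (2 * q) * hypersurfaceForm q r α β X := by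
  obtain ⟨n, rfl⟩ := Nat.exists_eq_add_of_le' hq
  have h1 : 2 * (n + 1) - 1 = 2 * n + 1 := by omega
  have h2 : 2 * (n + 1) - 2 = 2 * n := by omega
  simp only [hypersurfaceForm, Pi.smul_apply, smul_eq_mul, mul_pow, ← Finset.mul_sum,
    h1, h2, Nat.add_sub_cancel]
  ring

/-- The set of points of `PG(r, q²)` on the hypersurface. -/
def hypersurface {K : Type*} [Field K] (q r : ℕ) (α β : K) :
    Set (Projectivization K (Fin (r + 1) → K)) :=
  {P | hypersurfaceForm q r α β P.rep = 0}

/-- Membership in the hypersurface may be tested on any vector representing the point. -/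
theorem mk_mem_hypersurface_iff {K : Type*} [Field K] {q : ℕ} (hq : 1 ≤ q) (r : ℕ) (α β : K)
    (X : Fin (r + 1) → K) (hX : X ≠ 0) :
    Projectivization.mk K X hX ∈ hypersurface q r α β ↔ hypersurfaceForm q r α β X = 0 := by
  obtain ⟨a, ha⟩ := Projectivization.exists_smul_eq_mk_rep K X hX
  have ha' : (a : K) • X = (Projectivization.mk K X hX).rep := ha
  simp only [hypersurface, Set.mem_ofPred_eq]
  rw [← ha', hypersurfaceForm_smul hq]
  simp

/-- The conditions imposed on the coefficients `α, β ∈ GF(q²)` for odd `q`.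
The subfield `GF(q)` of the field with `q²` elements consists of the `y` with `y ^ q = y`. -/
def AdmissibleCoeffs {K : Type*} [Field K] (q r : ℕ) (α β : K) : Prop :=
  α ≠ 0 ∧ β ^ q ≠ β ∧
    ((Odd r ∧ 4 * α ^ (q + 1) + (β ^ q - β) ^ 2 ≠ 0) ∨
      (Even r ∧ ¬ ∃ y : K, y ^ q = y ∧ y ^ 2 = 4 * α ^ (q + 1) + (β ^ q - β) ^ 2))

/-- `H` is a generator matrix of the linear code `C`: its rows are a basis of `C`. -/
def IsGeneratorMatrix {K : Type*} [Field K] {k n : ℕ} (H : Matrix (Fin k) (Fin n) K)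
    (C : Submodule K (Fin n → K)) : Prop :=
  LinearIndependent K H.row ∧ Submodule.span K (Set.range H.row) = C

/-- The code determined by the projective system represented by the vectors
`v 0, …, v (n - 1)`: the row space of the matrix whose columns are these vectors. -/
def projectiveCode {K : Type*} [Field K] {n s : ℕ} (v : Fin n → Fin s → K) :
    Submodule K (Fin n → K) :=
  Submodule.span K (Set.range (Matrix.of v).transpose.row)

/-- The dual code. -/
def dualCode {K : Type*} [Field K] {n : ℕ} (C : Submodule K (Fin n → K)) :
    Submodule K (Fin n → K) where
  carrier := {x | ∀ c ∈ C, x ⬝ᵥ c = 0}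
  zero_mem' := fun c _ => zero_dotProduct c
  add_mem' := fun {x y} hx hy c hc => by rw [add_dotProduct, hx c hc, hy c hc, add_zero]
  smul_mem' := fun a x hx c hc => by rw [smul_dotProduct, hx c hc, smul_zero]

/-- In the secret sharing scheme with generator matrix `H = (g_0, …, g_m)`, the dealer's vector
`u` gives the secret `u g_0`. -/
def secret {K : Type*} [Field K] {k m : ℕ} (H : Matrix (Fin k) (Fin (m + 1)) K)
    (u : Fin k → K) : K :=
  Matrix.vecMul u H 0

/-- The share `u g_{i+1}` of a participant. The participants `P_1, …, P_m` are indexed by `Fin m`,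
the element `i : Fin m` standing for `P_{i+1}`. -/
def share {K : Type*} [Field K] {k m : ℕ} (H : Matrix (Fin k) (Fin (m + 1)) K)
    (u : Fin k → K) (i : Fin m) : K :=
  Matrix.vecMul u H i.succ

/-- `A` is an access set: its members can compute the secret from their shares. -/
def IsAccessSet {K : Type*} [Field K] {k m : ℕ} (H : Matrix (Fin k) (Fin (m + 1)) K)
    (A : Finset (Fin m)) : Prop :=
  ∃ f : (A → K) → K, ∀ u : Fin k → K, f (fun i => share H u i) = secret H u

/-- `A` is an access set none of whose proper subsets is an access set. -/
def IsMinimalAccessSet {K : Type*} [Field K] {k m : ℕ} (H : Matrix (Fin k) (Fin (m + 1)) K)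
    (A : Finset (Fin m)) : Prop :=
  IsAccessSet H A ∧ ∀ A' : Finset (Fin m), A' ⊂ A → ¬ IsAccessSet H A'

/-- The set of all minimal access sets. -/
def accessStructure {K : Type*} [Field K] {k m : ℕ} (H : Matrix (Fin k) (Fin (m + 1)) K) :
    Set (Finset (Fin m)) :=
  {A | IsMinimalAccessSet H A}

/-- Every participant belongs to the same number of minimal access sets. -/
def IsDemocratic {K : Type*} [Field K] {k m : ℕ} (H : Matrix (Fin k) (Fin (m + 1)) K) : Prop :=
  ∀ i j : Fin m, {A ∈ accessStructure H | i ∈ A}.ncard = {A ∈ accessStructure H | j ∈ A}.ncard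

/-- The number of participants, as a function of `q` and `r`. -/
def numParticipants (q r : ℕ) : ℚ :=
  if Odd r then
    (q : ℚ) ^ (2 * r - 1) + (q : ℚ) ^ (r - 1)
      + ((q : ℚ) ^ (2 * (r - 1)) - (q : ℚ) ^ 2) / ((q : ℚ) ^ 2 - 1)
  else
    (q : ℚ) ^ (2 * r - 1) + ((q : ℚ) ^ (2 * (r - 1)) - (q : ℚ) ^ 2) / ((q : ℚ) ^ 2 - 1)

/-! Codewords of the projective code are linear forms evaluated at the points, so their zero sets
are hyperplane sections of the hypersurface. By duality (`isAccessSet_iff_exists`) a set of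
participants is an access set exactly when some form equals 1 at `v 0` and vanishes at every
participant outside the set.

The geometric core, `exists_eq_smul_of_section`, says that every hyperplane section spans its
hyperplane. Hence normalized forms with nested zero sets coincide, and minimal access sets
correspond bijectively to forms `a` with `v 0 ⬝ᵥ a = 1` (`bijOn_accessStructure`). There are `q ^ (2
* r)` such forms. Representatives of two distinct points are linearly independent, so requiring the
form to vanish at a given participant as well leaves `q ^ (2 * (r - 1))` of them; the difference is
the number of minimal access sets containing that participant.

For the number of points, the affine equation has the form `t ^ q - t = z` with `z ^ q = -z`, so it
has `q` solutions over each choice of middle coordinates. At infinity lies a cone over the quadric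
`∑ x i ^ 2 = 0`, which is counted by recursion because `-1` is a square. -/

/-! ### Arithmetic of GF(q²) over GF(q) -/

theorem exists_pow_ringHom {K : Type*} [Field K] [Finite K] {q : ℕ} (hq : IsPrimePow q)
    (hK : Nat.card K = q ^ 2) : ∃ φ : K →+* K, ∀ x, φ x = x ^ q := by
  obtain ⟨p, k, hp, hk, rfl⟩ := (isPrimePow_nat_iff q).1 hq
  have := Fintype.ofFinite K
  obtain ⟨p', hp'⟩ := CharP.exists K
  obtain ⟨n, hpr, hn⟩ := FiniteField.card K p'
  have hdvd : p' ∣ p := by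
    have h : p' ∣ (p ^ k) ^ 2 := by
      rw [← hK, Nat.card_eq_fintype_card, hn]
      exact dvd_pow_self _ n.ne_zero
    exact hpr.dvd_of_dvd_pow (hpr.dvd_of_dvd_pow h)
  obtain rfl := (Nat.prime_dvd_prime_iff_eq hpr hp).1 hdvd
  have : ExpChar K p' := ExpChar.prime hpr
  exact ⟨iterateFrobenius K p' k, fun x => iterateFrobenius_def p' k x⟩

theorem pow_pow_card {K : Type*} [Field K] [Finite K] {q : ℕ}
    (hK : Nat.card K = q ^ 2) (x : K) : (x ^ q) ^ q = x := by
  have := Fintype.ofFinite K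
  rw [← pow_mul, ← sq, ← hK, Nat.card_eq_fintype_card, FiniteField.pow_card]

theorem two_ne_zero_of_odd_card {K : Type*} [Field K] [Finite K] {q : ℕ} (hodd : Odd q)
    (hK : Nat.card K = q ^ 2) : (2 : K) ≠ 0 := by
  have := Fintype.ofFinite K
  refine Ring.two_ne_zero fun h => ?_
  have h2 := FiniteField.even_card_of_char_two h
  rw [← Nat.card_eq_fintype_card, hK] at h2
  have := Nat.odd_iff.1 (hodd.pow (n := 2))
  omega

theorem exists_sq_eq_neg_one {K : Type*} [Field K] [Finite K] {q : ℕ} (hodd : Odd q)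
    (hK : Nat.card K = q ^ 2) : ∃ ι : K, ι ^ 2 = -1 := by
  have := Fintype.ofFinite K
  have h : IsSquare (-1 : K) := by
    rw [FiniteField.isSquare_neg_one_iff, ← Nat.card_eq_fintype_card, hK]
    obtain ⟨s, rfl⟩ := hodd
    ring_nf
    omega
  obtain ⟨ι, h⟩ := h
  exact ⟨ι, by rw [sq, h]⟩

/-- With `c = 1` and `c = -1` this bounds the kernel and the image of `t ↦ t ^ q - t`. -/
theorem ncard_pow_eq_mul_le {K : Type*} [Field K] {q : ℕ} (hq : 1 < q) (c : K) :
    {z : K | z ^ q = c * z}.ncard ≤ q := by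
  have hdeg : (Polynomial.X ^ q - Polynomial.C c * Polynomial.X : Polynomial K).natDegree = q := by
    rw [Polynomial.natDegree_sub_eq_left_of_natDegree_lt, Polynomial.natDegree_X_pow]
    rw [Polynomial.natDegree_X_pow]
    exact (Polynomial.natDegree_C_mul_le _ _).trans_lt (by simpa using hq)
  have hne : (Polynomial.X ^ q - Polynomial.C c * Polynomial.X : Polynomial K) ≠ 0 := by
    intro h
    rw [h, Polynomial.natDegree_zero] at hdeg
    omega
  classical
  have hsub : {z : K | z ^ q = c * z} ⊆
      ((Polynomial.X ^ q - Polynomial.C c * Polynomial.X : Polynomial K).roots.toFinset : Set K) := by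
    intro z hz
    have hz' : z ^ q = c * z := hz
    simp [hne, hz']
  refine (Set.ncard_le_ncard hsub (Finset.finite_toSet _)).trans ?_
  rw [Set.ncard_coe_finset]
  exact (Multiset.toFinset_card_le _).trans ((Polynomial.card_roots' _).trans hdeg.le)

/-- The map `t ↦ t ^ q - t` has all its fibres of size `q` over the elements `z` with
`z ^ q = -z`. -/
theorem ncard_pow_sub_self_eq {K : Type*} [Field K] [Finite K] {q : ℕ} (hq : IsPrimePow q)
    (hK : Nat.card K = q ^ 2) :
    {t : K | t ^ q = t}.ncard = q ∧
      ∀ z : K, z ^ q = -z → {t : K | t ^ q - t = z}.ncard = q := by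
  obtain ⟨φ, hφ⟩ := exists_pow_ringHom hq hK
  have h1 := hq.one_lt
  let D : K →+ K := φ.toAddMonoidHom - AddMonoidHom.id K
  have hD : ∀ t, D t = t ^ q - t := fun t => by simp [D, hφ]
  have hker : (D.ker : Set K) = {t : K | t ^ q = t} := by
    ext t
    simp [AddMonoidHom.mem_ker, hD, sub_eq_zero]
  have hrange : (D.range : Set K) ⊆ {z : K | z ^ q = -1 * z} := by
    rintro _ ⟨t, rfl⟩
    change (D t) ^ q = _
    rw [← hφ, hD, map_sub, hφ, hφ, pow_pow_card hK]
    ring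
  have hk : Nat.card D.ker ≤ q := by
    have := ncard_pow_eq_mul_le h1 (1 : K)
    simp only [one_mul] at this
    rw [← hker] at this
    exact this
  have hr : Nat.card D.range ≤ q :=
    (Set.ncard_le_ncard hrange (Set.toFinite _)).trans (ncard_pow_eq_mul_le h1 _)
  -- Two factors at most `q` with product `q * q` must both equal `q`.
  have hmul : Nat.card D.ker * Nat.card D.range = q * q := by
    rw [← sq, ← hK, ← AddSubgroup.index_ker, AddSubgroup.card_mul_index]
  have hkq : Nat.card D.ker = q := by
    refine le_antisymm hk (Nat.le_of_mul_le_mul_right ?_ (by omega : 0 < q))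
    rw [← hmul]
    exact Nat.mul_le_mul_left _ hr
  have hrq : Nat.card D.range = q := by
    rw [hkq] at hmul
    exact Nat.eq_of_mul_eq_mul_left (by omega) hmul
  have hrange' : (D.range : Set K) = {z : K | z ^ q = -1 * z} :=
    Set.eq_of_subset_of_ncard_le hrange
      ((ncard_pow_eq_mul_le h1 _).trans hrq.ge) (Set.toFinite _)
  refine ⟨by rw [← hker]; exact hkq, fun z hz => ?_⟩
  have hz' : z ∈ (D.range : Set K) := by
    rw [hrange']
    simpa using hz
  obtain ⟨t₀, rfl⟩ := hz'
  have himg : {t : K | t ^ q - t = D t₀} = (fun s => t₀ + s) '' (D.ker : Set K) := by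
    ext t
    simp only [← hD, Set.mem_ofPred_eq, Set.mem_image, SetLike.mem_coe, AddMonoidHom.mem_ker]
    constructor
    · intro h
      exact ⟨t - t₀, by rw [map_sub, h, sub_self], by ring⟩
    · rintro ⟨s, hs, rfl⟩
      rw [map_add, hs, add_zero]
  rw [himg, Set.ncard_image_of_injective _ (add_right_injective t₀)]
  exact hkq

/-- An inhomogeneous binary diagonal quadratic equation over `GF(q)` has a solution. -/
theorem exists_fixed_sum_quadratic_eq_zero {K : Type*} [Field K] [Finite K] {q : ℕ}
    (hq : IsPrimePow q) (hodd : Odd q) (hK : Nat.card K = q ^ 2) {e b₁ b₂ d : K}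
    (he0 : e ≠ 0) (he : e ^ q = e) (hb₁ : b₁ ^ q = b₁) (hb₂ : b₂ ^ q = b₂) (hd : d ^ q = d) :
    ∃ s t : K, s ^ q = s ∧ t ^ q = t ∧ (e * s ^ 2 + b₁ * s) + (e * t ^ 2 + b₂ * t) + d = 0 := by
  obtain ⟨φ, hφ⟩ := exists_pow_ringHom hq hK
  let F : Subfield K := φ.eqLocusField (RingHom.id K)
  have hF : ∀ x, x ∈ F ↔ x ^ q = x := fun x => by
    rw [← hφ]
    rfl
  have : Fintype F := Fintype.ofFinite F
  have hcard : Fintype.card F = q := by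
    rw [← Nat.card_eq_fintype_card]
    have h : (F : Set K) = {t : K | t ^ q = t} := Set.ext hF
    exact (congrArg Set.ncard h).trans (ncard_pow_sub_self_eq hq hK).1
  let e' : F := ⟨e, (hF e).2 he⟩
  let b₁' : F := ⟨b₁, (hF b₁).2 hb₁⟩
  let b₂' : F := ⟨b₂, (hF b₂).2 hb₂⟩
  let d' : F := ⟨d, (hF d).2 hd⟩
  have he' : e' ≠ 0 := fun h => he0 (congrArg Subtype.val h)
  -- Over GF(q), `q` odd, a quadratic takes `(q + 1) / 2` values, so the value sets of `f` and `-g`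
  -- meet.
  open Polynomial in
  obtain ⟨s, t, hst⟩ := FiniteField.exists_root_sum_quadratic
    (f := C e' * X ^ 2 + C b₁' * X + C 0) (g := C e' * X ^ 2 + C b₂' * X + C d')
    (Polynomial.degree_quadratic he') (Polynomial.degree_quadratic he')
    (by rw [hcard]; exact Nat.odd_iff.1 hodd)
  refine ⟨s, t, (hF s).1 s.2, (hF t).1 t.2, ?_⟩
  have h := congrArg (Subtype.val : F → K) hst
  simp [e', b₁', b₂', d'] at h
  linear_combination h

/-! ### Coordinates; affine points and points at infinity -/

/-- The vector with first coordinate `x₀`, middle coordinates `x` and last coordinate `t`. -/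
def coordVec {K : Type*} {n : ℕ} (x₀ : K) (x : Fin n → K) (t : K) : Fin (n + 1 + 1) → K :=
  Fin.cons x₀ (Fin.snoc (α := fun _ => K) x t)

@[simp]
theorem coordVec_zero {K : Type*} {n : ℕ} (x₀ : K) (x : Fin n → K) (t : K) :
    coordVec x₀ x t 0 = x₀ := rfl

@[simp]
theorem coordVec_last {K : Type*} {n : ℕ} (x₀ : K) (x : Fin n → K) (t : K) :
    coordVec x₀ x t (Fin.last (n + 1)) = t := by
  rw [← Fin.succ_last, coordVec, Fin.cons_succ, Fin.snoc_last]

@[simp]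
theorem coordVec_castSucc_succ {K : Type*} {n : ℕ} (x₀ : K) (x : Fin n → K) (t : K) (i : Fin n) :
    coordVec x₀ x t i.castSucc.succ = x i := by
  rw [coordVec, Fin.cons_succ, Fin.snoc_castSucc]

theorem sum_eq_zero_add_middle_add_last {M : Type*} [AddCommMonoid M] {n : ℕ}
    (g : Fin (n + 1 + 1) → M) :
    ∑ i, g i = g 0 + (∑ i : Fin n, g i.castSucc.succ + g (Fin.last (n + 1))) := by
  rw [Fin.sum_univ_succ, Fin.sum_univ_castSucc, Fin.succ_last]

theorem sum_Ioo_zero_last {M : Type*} [AddCommMonoid M] {n : ℕ} (g : Fin (n + 1 + 1) → M) :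
    ∑ i ∈ Finset.Ioo 0 (Fin.last (n + 1)), g i = ∑ i : Fin n, g i.castSucc.succ := by
  symm
  refine Finset.sum_bij (fun i _ => i.castSucc.succ) (fun i _ => ?_) (fun i _ j _ h => ?_)
    (fun j hj => ?_) (fun _ _ => rfl)
  · simp only [Finset.mem_Ioo, Fin.lt_def, Fin.val_last, Fin.val_succ, Fin.val_castSucc,
      Fin.val_zero]
    omega
  · simpa using h
  · simp only [Finset.mem_Ioo, Fin.lt_def, Fin.val_last, Fin.val_zero] at hj
    exact ⟨⟨j - 1, by omega⟩, Finset.mem_univ _, Fin.ext (by simp; omega)⟩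

/-- Splitting off the first and the last coordinate of a vector. -/
def coordEquiv (K : Type*) (n : ℕ) : K × (Fin n → K) × K ≃ (Fin (n + 1 + 1) → K) where
  toFun y := coordVec y.1 y.2.1 y.2.2
  invFun X := (X 0, fun i => X i.castSucc.succ, X (Fin.last (n + 1)))
  left_inv y := by simp
  right_inv X := by
    ext i
    refine Fin.cases (by simp) (fun j => ?_) i
    refine Fin.lastCases ?_ (fun i => by simp) j
    exact coordVec_last _ _ _

@[simp]
theorem coordEquiv_apply {K : Type*} {n : ℕ} (y : K × (Fin n → K) × K) :
    coordEquiv K n y = coordVec y.1 y.2.1 y.2.2 := rfl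

theorem exists_eq_coordVec {K : Type*} {n : ℕ} (X : Fin (n + 1 + 1) → K) :
    ∃ x₀ x t, X = coordVec x₀ x t :=
  ⟨_, _, _, ((coordEquiv K n).apply_symm_apply X).symm⟩

theorem coordVec_dotProduct {K : Type*} [Field K] {n : ℕ} (x₀ y₀ : K) (x y : Fin n → K) (s t : K) :
    coordVec x₀ x s ⬝ᵥ coordVec y₀ y t = x₀ * y₀ + (x ⬝ᵥ y + s * t) := by
  simp [dotProduct, sum_eq_zero_add_middle_add_last]

theorem smul_coordVec {K : Type*} [Field K] {n : ℕ} (c x₀ : K) (x : Fin n → K) (t : K) :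
    c • coordVec x₀ x t = coordVec (c * x₀) (c • x) (c * t) := by
  ext i
  refine Fin.cases (by simp) (fun j => ?_) i
  refine Fin.lastCases ?_ (fun i => by simp) j
  simp [Fin.succ_last]

theorem hypersurfaceForm_coordVec {K : Type*} [Field K] (q n : ℕ) (α β x₀ : K) (x : Fin n → K)
    (t : K) : hypersurfaceForm q (n + 1) α β (coordVec x₀ x t) =
      t ^ q * x₀ ^ q - t * x₀ ^ (2 * q - 1) + α ^ q * (∑ i, x i ^ (2 * q))
        - α * (∑ i, x i ^ 2) * x₀ ^ (2 * q - 2)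
        - (β ^ q - β) * (∑ i, x i ^ (q + 1)) * x₀ ^ (q - 1) := by
  simp [hypersurfaceForm, sum_Ioo_zero_last]

theorem hypersurfaceForm_one {K : Type*} [Field K] (q n : ℕ) (α β : K) (x : Fin n → K)
    (t : K) : hypersurfaceForm q (n + 1) α β (coordVec 1 x t) =
      t ^ q - t - ∑ i, (α * x i ^ 2 + (β ^ q - β) * x i ^ (q + 1) - α ^ q * x i ^ (2 * q)) := by
  rw [hypersurfaceForm_coordVec, Finset.sum_sub_distrib, Finset.sum_add_distrib,
    Finset.mul_sum, Finset.mul_sum, Finset.mul_sum]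
  ring

/-- The points at infinity form a cone over a quadric. -/
theorem hypersurfaceForm_infinity_iff {K : Type*} [Field K] [Finite K] {q : ℕ} (hq : IsPrimePow q)
    (hK : Nat.card K = q ^ 2) (n : ℕ) {α : K} (hα : α ≠ 0) (β : K) (x : Fin n → K) (t : K) :
    hypersurfaceForm q (n + 1) α β (coordVec 0 x t) = 0 ↔ ∑ i, x i ^ 2 = 0 := by
  obtain ⟨φ, hφ⟩ := exists_pow_ringHom hq hK
  have h1 := hq.one_lt
  have h : ∑ i, x i ^ (2 * q) = (∑ i, x i ^ 2) ^ q := by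
    rw [← hφ, map_sum]
    simp [hφ, pow_mul]
  rw [hypersurfaceForm_coordVec, h, zero_pow (by omega), zero_pow (by omega), zero_pow (by omega),
    zero_pow (by omega)]
  have h2 : q ≠ 0 := by omega
  simp [hα, h2]

/-- The `q`-th power swaps `α * x ^ 2` and `α ^ q * x ^ (2 * q)`, fixes the norm `x ^ (q + 1)` and
negates `β ^ q - β`. -/
theorem affine_term_pow {K : Type*} [Field K] [Finite K] {q : ℕ} (hq : IsPrimePow q)
    (hK : Nat.card K = q ^ 2) (α β x : K) :
    (α * x ^ 2 + (β ^ q - β) * x ^ (q + 1) - α ^ q * x ^ (2 * q)) ^ q =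
      -(α * x ^ 2 + (β ^ q - β) * x ^ (q + 1) - α ^ q * x ^ (2 * q)) := by
  obtain ⟨φ, hφ⟩ := exists_pow_ringHom hq hK
  have h (y : K) : φ (φ y) = y := by rw [hφ, hφ, pow_pow_card hK]
  have h2 (y : K) : y ^ (2 * q) = φ y ^ 2 := by rw [hφ, ← pow_mul, mul_comm]
  rw [h2, pow_succ x q, ← hφ, ← hφ, ← hφ, ← hφ]
  simp only [map_add, map_sub, map_mul, map_pow, h]
  ring

/-- Every value `x₀ ≠ 0` of the first coordinate and all values of the middle ones extend
to `q` vectors on the hypersurface. -/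
theorem ncard_last_coord {K : Type*} [Field K] [Finite K] {q : ℕ} (hq : IsPrimePow q)
    (hK : Nat.card K = q ^ 2) (n : ℕ) (α β : K) {x₀ : K} (hx₀ : x₀ ≠ 0) (x : Fin n → K) :
    {t : K | hypersurfaceForm q (n + 1) α β (coordVec x₀ x t) = 0}.ncard = q := by
  obtain ⟨φ, hφ⟩ := exists_pow_ringHom hq hK
  set z := ∑ i, (α * (x₀⁻¹ • x) i ^ 2 + (β ^ q - β) * (x₀⁻¹ • x) i ^ (q + 1)
    - α ^ q * (x₀⁻¹ • x) i ^ (2 * q)) with hz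
  have hzq : z ^ q = -z := by
    rw [hz, ← hφ, map_sum, ← Finset.sum_neg_distrib]
    exact Finset.sum_congr rfl fun i _ => by rw [hφ, affine_term_pow hq hK]
  have himg : {t : K | hypersurfaceForm q (n + 1) α β (coordVec x₀ x t) = 0} =
      (fun s => x₀ * s) '' {s : K | s ^ q - s = z} := by
    ext t
    have ht : coordVec x₀ x t = x₀ • coordVec 1 (x₀⁻¹ • x) (x₀⁻¹ * t) := by
      rw [smul_coordVec, smul_smul, mul_inv_cancel₀ hx₀, one_smul, mul_one,
        mul_inv_cancel_left₀ hx₀]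
    simp only [Set.mem_ofPred_eq, Set.mem_image]
    rw [ht, hypersurfaceForm_smul hq.one_lt.le, mul_eq_zero, or_iff_right (pow_ne_zero _ hx₀),
      hypersurfaceForm_one, ← hz, sub_eq_zero]
    constructor
    · intro h
      exact ⟨_, h, mul_inv_cancel_left₀ hx₀ t⟩
    · rintro ⟨s, hs, rfl⟩
      rwa [inv_mul_cancel_left₀ hx₀]
  rw [himg, Set.ncard_image_of_injective _ (mul_right_injective₀ hx₀)]
  exact (ncard_pow_sub_self_eq hq hK).2 z hzq

/-! ### Counting the points -/

/-- The number of vectors on the hypersurface, zero included, in terms of the number of points. -/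
theorem ncard_hypersurface_mul {K : Type*} [Field K] [Finite K] {q : ℕ} (hq : 1 ≤ q) (r : ℕ)
    (α β : K) :
    {X : Fin (r + 1) → K | hypersurfaceForm q r α β X = 0}.ncard =
      (hypersurface q r α β).ncard * (Nat.card K - 1) + 1 := by
  have hzero : hypersurfaceForm q r α β (0 : Fin (r + 1) → K) = 0 := by
    have h := hypersurfaceForm_smul hq r α β 0 (0 : Fin (r + 1) → K)
    rwa [smul_zero, zero_pow (by omega), zero_mul] at h
  set Z := {X : Fin (r + 1) → K | hypersurfaceForm q r α β X = 0}
  have hbij : Function.Bijective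
      (fun y : hypersurface q r α β × Kˣ =>
        (⟨(y.2 : K) • y.1.1.rep, by
          refine ⟨?_, ?_⟩
          · have h : hypersurfaceForm q r α β y.1.1.rep = 0 := y.1.2
            change hypersurfaceForm q r α β _ = 0
            rw [hypersurfaceForm_smul hq, h, mul_zero]
          · exact smul_ne_zero y.2.ne_zero (Projectivization.rep_nonzero _)⟩ :
          (Z \ {0} : Set (Fin (r + 1) → K)))) := by
    constructor
    · rintro ⟨⟨P, hP⟩, c⟩ ⟨⟨P', hP'⟩, c'⟩ h
      have h' : (c : K) • P.rep = (c' : K) • P'.rep := congrArg Subtype.val h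
      have hPP : P = P' := by
        rw [← P.mk_rep, ← P'.mk_rep, Projectivization.mk_eq_mk_iff]
        refine ⟨c⁻¹ * c', ?_⟩
        rw [mul_smul, Units.smul_def c', ← h', ← Units.smul_def, inv_smul_smul]
      subst hPP
      have hc : c = c' := Units.ext (smul_left_injective K P.rep_nonzero h')
      rw [hc]
    · rintro ⟨X, hX, hX0⟩
      have hX0' : X ≠ 0 := hX0
      obtain ⟨a, ha⟩ := Projectivization.exists_smul_eq_mk_rep K X hX0'
      refine ⟨⟨⟨Projectivization.mk K X hX0', (mk_mem_hypersurface_iff hq r α β X hX0').2 hX⟩,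
        a⁻¹⟩, Subtype.ext ?_⟩
      change ((a⁻¹ : Kˣ) : K) • (Projectivization.mk K X hX0').rep = X
      rw [← ha, ← Units.smul_def, inv_smul_smul]
  have hcard := Nat.card_congr (Equiv.ofBijective _ hbij)
  rw [Nat.card_prod, Nat.card_units] at hcard
  have h0 : (0 : Fin (r + 1) → K) ∈ Z := hzero
  rw [← Set.ncard_sdiff_singleton_add_one h0 (Set.toFinite _)]
  exact congrArg (· + 1) hcard.symm

theorem ncard_eq_sum_ite {S : Type*} [Fintype S] (p : S → Prop) [DecidablePred p] :
    {x | p x}.ncard = ∑ x, if p x then 1 else 0 := by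
  rw [Set.ncard_eq_toFinset_card', Finset.card_eq_sum_ones, Finset.sum_ite, Finset.sum_const_zero,
    add_zero]
  exact Finset.sum_congr (by ext; simp) fun _ _ => rfl

/-- Each `u ≠ 0` has a unique partner, while `u = 0` contributes only when `s = 0`. The `+ 1` avoids
truncated subtraction. -/
theorem ncard_mul_eq {K : Type*} [Field K] [Fintype K] [DecidableEq K] (s : K) :
    {y : K × K | y.1 * y.2 = s}.ncard + 1 =
      Fintype.card K + if s = 0 then Fintype.card K else 0 := by
  have hinner (u : K) : (∑ v : K, if u * v = s then 1 else 0) =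
      if u = 0 then (if s = 0 then Fintype.card K else 0) else 1 := by
    by_cases hu : u = 0
    · simp [hu, eq_comm (a := (0 : K))]
    · have h (v : K) : u * v = s ↔ v = u⁻¹ * s := by
        rw [eq_inv_mul_iff_mul_eq₀ hu]
      simp [h, hu]
  rw [ncard_eq_sum_ite, Fintype.sum_prod_type]
  simp only [hinner]
  rw [← Finset.add_sum_erase _ _ (Finset.mem_univ (0 : K)), if_pos rfl,
    Finset.sum_congr rfl (fun u hu => if_neg (Finset.ne_of_mem_erase hu)), Finset.sum_const,
    Finset.card_erase_of_mem (Finset.mem_univ _), Finset.card_univ, smul_eq_mul, mul_one]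
  have : 0 < Fintype.card K := Fintype.card_pos
  omega

/-- The factorization `y ^ 2 + z ^ 2 = (y + ι * z) * (y - ι * z)` reduces this to `ncard_mul_eq`. -/
theorem ncard_sq_add_sq_eq {K : Type*} [Field K] [Fintype K] [DecidableEq K] {ι : K}
    (hι : ι ^ 2 = -1) (h2 : (2 : K) ≠ 0) (s : K) :
    {y : K × K | y.1 ^ 2 + y.2 ^ 2 = s}.ncard + 1 =
      Fintype.card K + if s = 0 then Fintype.card K else 0 := by
  have hι0 : ι ≠ 0 := by
    rintro rfl
    simp at hι
  have himg : {y : K × K | y.1 * y.2 = s} =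
      (fun y : K × K => (y.1 + ι * y.2, y.1 - ι * y.2)) '' {y : K × K | y.1 ^ 2 + y.2 ^ 2 = s} := by
    ext ⟨u, v⟩
    simp only [Set.mem_ofPred_eq, Set.mem_image, Prod.mk.injEq, Prod.exists]
    constructor
    · intro h
      refine ⟨(u + v) / 2, (u - v) / (2 * ι), ?_, ?_, ?_⟩
      · rw [div_pow, div_pow, mul_pow, hι, ← h]
        field_simp
        ring
      · field_simp
        ring
      · field_simp
        ring
    · rintro ⟨y, z, h, rfl, rfl⟩
      linear_combination h - z ^ 2 * hι
  rw [← ncard_mul_eq, himg, Set.ncard_image_of_injective]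
  rintro ⟨y, z⟩ ⟨y', z'⟩ h
  simp only [Prod.mk.injEq] at h
  obtain ⟨h3, h4⟩ := h
  have hy : 2 * y = 2 * y' := by linear_combination h3 + h4
  have hz : (2 * ι) * z = (2 * ι) * z' := by linear_combination h3 - h4
  rw [mul_left_cancel₀ h2 hy, mul_left_cancel₀ (mul_ne_zero h2 hι0) hz]

/-- Fix the `n` middle coordinates and count pairs of outer ones by `ncard_sq_add_sq_eq`; its `+ 1`,
summed over all middles, is the term added on the left. -/
theorem ncard_sum_sq_eq_zero_step {K : Type*} [Field K] [Fintype K] {ι : K}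
    (hι : ι ^ 2 = -1) (h2 : (2 : K) ≠ 0) (n : ℕ) :
    {x : Fin (n + 1 + 1) → K | ∑ i, x i ^ 2 = 0}.ncard + Fintype.card K ^ n =
      Fintype.card K ^ n * Fintype.card K +
        {x : Fin n → K | ∑ i, x i ^ 2 = 0}.ncard * Fintype.card K := by
  classical
  have hstep : {x : Fin (n + 1 + 1) → K | ∑ i, x i ^ 2 = 0}.ncard =
      ∑ x : Fin n → K, {y : K × K | y.1 ^ 2 + y.2 ^ 2 = -∑ i, x i ^ 2}.ncard := by
    simp only [ncard_eq_sum_ite]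
    rw [← (coordEquiv K n).sum_comp, Fintype.sum_prod_type, Finset.sum_congr rfl
      fun _ _ => Fintype.sum_prod_type _, Finset.sum_comm]
    refine Finset.sum_congr rfl fun x _ => ?_
    rw [Fintype.sum_prod_type]
    refine Finset.sum_congr rfl fun y _ => Finset.sum_congr rfl fun z _ => ?_
    simp only [coordEquiv_apply, sum_eq_zero_add_middle_add_last, coordVec_zero,
      coordVec_castSucc_succ, coordVec_last]
    congr 1
    rw [eq_neg_iff_add_eq_zero, eq_iff_iff]
    constructor <;> intro h <;> linear_combination h
  have hn : Fintype.card K ^ n = ∑ _x : Fin n → K, 1 := by simp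
  rw [hstep]
  nth_rw 1 [hn]
  rw [← Finset.sum_add_distrib]
  simp only [ncard_sq_add_sq_eq hι h2, neg_eq_zero]
  rw [Finset.sum_add_distrib, ncard_eq_sum_ite, Finset.sum_mul]
  simp

/-- The number of zeros of a sum of `n` squares over a field where `-1` is a square. -/
theorem ncard_sum_sq_eq_zero {K : Type*} [Field K] [Fintype K] {ι : K}
    (hι : ι ^ 2 = -1) (h2 : (2 : K) ≠ 0) (k : ℕ) :
    {x : Fin (2 * k + 1) → K | ∑ i, x i ^ 2 = 0}.ncard = Fintype.card K ^ (2 * k) ∧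
    {x : Fin (2 * k + 2) → K | ∑ i, x i ^ 2 = 0}.ncard + Fintype.card K ^ k =
      Fintype.card K ^ (2 * k + 1) + Fintype.card K ^ (k + 1) := by
  induction k with
  | zero =>
    constructor
    · have h : {x : Fin (2 * 0 + 1) → K | ∑ i, x i ^ 2 = 0} = {0} := by
        ext x
        simp [funext_iff, Fin.forall_fin_one]
      rw [h]
      simp
    · have h := ncard_sum_sq_eq_zero_step hι h2 0
      simpa using h
  | succ k ih =>
    have h1 := ncard_sum_sq_eq_zero_step hι h2 (2 * k + 1)
    have h2 := ncard_sum_sq_eq_zero_step hι h2 (2 * k + 2)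
    rw [ih.1] at h1
    constructor
    · refine Nat.add_right_cancel (h1.trans ?_)
      ring
    · have e : 2 * (k + 1) + 2 = 2 * k + 2 + 1 + 1 := by ring
      rw [e]
      -- This summand lets the recursion combine with `Fintype.card K` times the inductive count
      -- without subtraction.
      refine Nat.add_right_cancel (m := Fintype.card K ^ (2 * k + 2)) ?_
      have h3 := congrArg (· * Fintype.card K) ih.2
      simp only [add_mul] at h3
      ring_nf at h2 h3 ⊢
      omega

/-- Over `x₀ = 0` the last coordinate is free; over each `x₀ ≠ 0` every middle vector extends in `q`
ways. -/
theorem ncard_hypersurfaceForm_eq_zero {K : Type*} [Field K] [Finite K] {q : ℕ}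
    (hq : IsPrimePow q) (hK : Nat.card K = q ^ 2) (n : ℕ) {α : K} (hα : α ≠ 0) (β : K) :
    {X : Fin (n + 1 + 1) → K | hypersurfaceForm q (n + 1) α β X = 0}.ncard =
      {x : Fin n → K | ∑ i, x i ^ 2 = 0}.ncard * q ^ 2 + (q ^ 2 - 1) * ((q ^ 2) ^ n * q) := by
  classical
  have := Fintype.ofFinite K
  have hK' : Fintype.card K = q ^ 2 := by rw [← hK, Nat.card_eq_fintype_card]
  have hstep : {X : Fin (n + 1 + 1) → K | hypersurfaceForm q (n + 1) α β X = 0}.ncard =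
      ∑ x₀ : K, ∑ x : Fin n → K,
        {t : K | hypersurfaceForm q (n + 1) α β (coordVec x₀ x t) = 0}.ncard := by
    simp only [ncard_eq_sum_ite]
    rw [← (coordEquiv K n).sum_comp, Fintype.sum_prod_type, Finset.sum_congr rfl
      fun _ _ => Fintype.sum_prod_type _]
    rfl
  rw [hstep, ← Finset.add_sum_erase _ _ (Finset.mem_univ (0 : K))]
  congr 1
  · simp only [hypersurfaceForm_infinity_iff hq hK n hα]
    rw [ncard_eq_sum_ite, Finset.sum_mul]
    refine Finset.sum_congr rfl fun x _ => ?_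
    rw [ncard_eq_sum_ite]
    split_ifs <;> simp [hK']
  · rw [Finset.sum_congr rfl fun x₀ hx₀ => Finset.sum_congr rfl fun x _ =>
      ncard_last_coord hq hK n α β (Finset.ne_of_mem_erase hx₀) x]
    simp [hK', Finset.card_erase_of_mem]

theorem ncard_hypersurface {K : Type*} [Field K] [Finite K] {q : ℕ} (hq : IsPrimePow q)
    (hodd : Odd q) (hK : Nat.card K = q ^ 2) {r : ℕ} (hr : 2 ≤ r) {α : K} (hα : α ≠ 0) (β : K) :
    ((hypersurface q r α β).ncard : ℚ) = numParticipants q r + 1 := by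
  have := Fintype.ofFinite K
  have hK' : Fintype.card K = q ^ 2 := by rw [← hK, Nat.card_eq_fintype_card]
  obtain ⟨n, rfl⟩ := Nat.exists_eq_add_of_le' (show 1 ≤ r by omega)
  obtain ⟨ι, hι⟩ := exists_sq_eq_neg_one hodd hK
  have h2 := two_ne_zero_of_odd_card hodd hK
  have h1 := hq.one_lt
  have hN := ncard_hypersurface_mul h1.le (n + 1) α β
  rw [ncard_hypersurfaceForm_eq_zero hq hK n hα β, hK] at hN
  have hq1 : 1 ≤ q ^ 2 := Nat.one_le_pow _ _ (by omega)
  have hq2 : (q : ℚ) ^ 2 - 1 ≠ 0 := by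
    have : (1 : ℚ) < (q : ℚ) ^ 2 := by
      exact_mod_cast Nat.one_lt_pow two_ne_zero h1
    linarith
  have hN' := congrArg (Nat.cast : ℕ → ℚ) hN
  push_cast [hq1] at hN'
  refine mul_right_cancel₀ hq2 ?_
  -- Since `r = n + 1`, even `n` (a hyperbolic quadric at infinity) is the case of odd `r`.
  rcases Nat.even_or_odd' n with ⟨k, rfl | rfl⟩
  · obtain ⟨k, rfl⟩ := Nat.exists_eq_add_of_le' (show 1 ≤ k by omega)
    have hA := congrArg (Nat.cast : ℕ → ℚ) (ncard_sum_sq_eq_zero hι h2 k).2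
    rw [hK'] at hA
    push_cast at hA
    rw [numParticipants, if_pos ⟨k + 1, rfl⟩, add_mul, add_mul, div_mul_cancel₀ _ hq2]
    have e1 : 2 * (2 * (k + 1) + 1) - 1 = 4 * k + 5 := by omega
    have e2 : 2 * (2 * (k + 1) + 1 - 1) = 4 * k + 4 := by omega
    have e3 : 2 * (k + 1) + 1 - 1 = 2 * k + 2 := by omega
    rw [e1, e2, e3]
    have e4 : 2 * (k + 1) = 2 * k + 2 := by ring
    simp only [e4] at hN' ⊢
    linear_combination -hN' + (q : ℚ) ^ 2 * hA
  · have hA := congrArg (Nat.cast : ℕ → ℚ) (ncard_sum_sq_eq_zero hι h2 k).1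
    rw [hK'] at hA
    push_cast at hA
    have hne : ¬ Odd (2 * k + 1 + 1) := by
      rw [Nat.not_odd_iff_even]
      exact ⟨k + 1, by ring⟩
    rw [numParticipants, if_neg hne, add_mul, add_mul, div_mul_cancel₀ _ hq2]
    have e1 : 2 * (2 * k + 1 + 1) - 1 = 4 * k + 3 := by omega
    have e2 : 2 * (2 * k + 1 + 1 - 1) = 4 * k + 2 := by omega
    rw [e1, e2]
    linear_combination -hN' + (q : ℚ) ^ 2 * hA

/-! ### Hyperplane sections span their hyperplanes -/

/-- As a polynomial in `u` it has degree at most `2 * q < q ^ 2`, and its exponents `2`, `q + 1`, `2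
* q` are distinct, so the coefficient `α` survives. -/
theorem exists_affine_term_ne_zero {K : Type*} [Field K] [Finite K] {q : ℕ} (hq : 3 ≤ q)
    (hK : Nat.card K = q ^ 2) {α : K} (hα : α ≠ 0) (γ : K) :
    ∃ u : K, α * u ^ 2 + γ * u ^ (q + 1) - α ^ q * u ^ (2 * q) ≠ 0 := by
  by_contra! h
  have := Fintype.ofFinite K
  open Polynomial in
  have hp : (C α * X ^ 2 + C γ * X ^ (q + 1) - C (α ^ q) * X ^ (2 * q) : K[X]) = 0 := by
    refine eq_zero_of_natDegree_lt_card_of_eval_eq_zero _ Function.injective_id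
      (fun u => by simpa using h u) ?_
    have hdeg : (C α * X ^ 2 + C γ * X ^ (q + 1) - C (α ^ q) * X ^ (2 * q) : K[X]).natDegree
        ≤ 2 * q := by
      compute_degree
      omega
    rw [← Nat.card_eq_fintype_card, hK]
    nlinarith
  have hc := congrArg (fun p => Polynomial.coeff p 2) hp
  simp only [Polynomial.coeff_sub, Polynomial.coeff_add, Polynomial.coeff_C_mul,
    Polynomial.coeff_X_pow, if_neg (by omega : 2 ≠ q + 1), if_neg (by omega : 2 ≠ 2 * q),
    if_true, Polynomial.coeff_zero, mul_zero, add_zero, sub_zero, mul_one] at hc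
  exact hα hc

/-- Every affine hyperplane that misses the point at infinity `(0, …, 0, 1)` contains an affine
point of the hypersurface. -/
theorem exists_affine_point {K : Type*} [Field K] [Finite K] {q : ℕ} (hq : IsPrimePow q)
    (hodd : Odd q) (hK : Nat.card K = q ^ 2) {n : ℕ} (hn : 2 ≤ n) {α β : K} (hα : α ≠ 0)
    (hβ : β ^ q ≠ β) (c₀ : K) (c : Fin n → K) :
    ∃ x : Fin n → K, hypersurfaceForm q (n + 1) α β (coordVec 1 x (c₀ + x ⬝ᵥ c)) = 0 := by
  obtain ⟨m, rfl⟩ := Nat.exists_eq_add_of_le' hn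
  obtain ⟨φ, hφ⟩ := exists_pow_ringHom hq hK
  have hφφ (y : K) : φ (φ y) = y := by rw [hφ, hφ, pow_pow_card hK]
  have h1 := hq.one_lt
  have h3 : 3 ≤ q := by
    obtain ⟨s, rfl⟩ := hodd
    omega
  set γ := β ^ q - β with hγ
  have hγ0 : γ ≠ 0 := sub_ne_zero.2 hβ
  have hγq : φ γ = -γ := by
    rw [hγ, map_sub, ← hφ, hφφ]
    ring
  obtain ⟨u, hu⟩ := exists_affine_term_ne_zero h3 hK hα γ
  have hfq := affine_term_pow hq hK α β u
  rw [← hγ] at hfq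
  set f := α * u ^ 2 + γ * u ^ (q + 1) - α ^ q * u ^ (2 * q) with hf
  have hb (y : K) : ((φ y - y) / γ) ^ q = (φ y - y) / γ := by
    rw [← hφ, map_div₀, map_sub, hφφ, hγq]
    field_simp
    ring
  -- Restricted to middle vectors `(s * u, t * u, 0, …)` with `s`, `t` in GF(q), the equation is
  -- quadratic in `s` and `t`. Its coefficients are negated by `φ`, as is `γ`, so dividing by `γ`
  -- puts them in GF(q).
  obtain ⟨s, t, hs, ht, hst⟩ := exists_fixed_sum_quadratic_eq_zero hq hodd hK
    (e := -f / γ) (b₁ := (φ (u * c 0) - u * c 0) / γ) (b₂ := (φ (u * c 1) - u * c 1) / γ)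
    (d := (φ c₀ - c₀) / γ) (div_ne_zero (neg_ne_zero.2 hu) hγ0)
    (by rw [← hφ, map_div₀, map_neg, hφ f, hfq, hγq]; field_simp)
    (hb _) (hb _) (hb _)
  refine ⟨Fin.cons (s * u) (Fin.cons (t * u) 0), ?_⟩
  have hscale {s : K} (hs : s ^ q = s) : α * (s * u) ^ 2 + γ * (s * u) ^ (q + 1)
      - α ^ q * (s * u) ^ (2 * q) = s ^ 2 * f := by
    rw [hf, mul_pow s u (q + 1), mul_pow s u (2 * q), pow_succ s q, mul_comm 2 q, pow_mul s, hs]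
    ring
  rw [hypersurfaceForm_one, ← hγ, ← hφ, Fin.sum_univ_succ, Fin.sum_univ_succ]
  simp only [Fin.cons_zero, Fin.cons_succ, hscale hs, hscale ht, dotProduct, Fin.sum_univ_succ,
    Pi.zero_apply, zero_mul, Finset.sum_const_zero, add_zero, map_add, map_mul, hφ s, hs, hφ t, ht]
  have hq0 : q ≠ 0 := by omega
  simp only [map_mul] at hst
  field_simp at hst
  simp [hq0]
  linear_combination hst

/-- The isotropic vectors `e_i ± ι e_j` already span: they give `b i ± ι * b j = 0`, hence `2 * b i
= 0`. -/
theorem eq_zero_of_isotropic_dotProduct {K : Type*} [Field K] {ι : K} (hι : ι ^ 2 = -1)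
    (h2 : (2 : K) ≠ 0) {n : ℕ} (hn : 2 ≤ n) {b : Fin n → K}
    (h : ∀ x : Fin n → K, ∑ i, x i ^ 2 = 0 → x ⬝ᵥ b = 0) : b = 0 := by
  have : Nontrivial (Fin n) := Fin.nontrivial_iff_two_le.2 hn
  ext i
  obtain ⟨j, hj⟩ := exists_ne i
  have key (c : K) (hc : c ^ 2 = -1) : b i + c * b j = 0 := by
    have h0 := h (Pi.single i 1 + Pi.single j c) ?_
    · simpa [add_dotProduct] using h0
    · have hk (k : Fin n) : (Pi.single i 1 + Pi.single j c : Fin n → K) k ^ 2 =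
          (Pi.single i 1 : Fin n → K) k + (Pi.single j (-1) : Fin n → K) k := by
        by_cases hki : k = i
        · subst hki
          simp [hj.symm]
        · by_cases hkj : k = j
          · subst hkj
            simp [hki, hc]
          · simp [hki, hkj]
      rw [Finset.sum_congr rfl fun k _ => hk k, Finset.sum_add_distrib]
      simp
  have h3 := key ι hι
  have h4 := key (-ι) (by rw [neg_sq, hι])
  have h5 : 2 * b i = 0 := by linear_combination h3 + h4
  simpa [h2] using h5

/-- Two linear forms, the second of which vanishes at all points of the hypersurface where the
first does, are proportional: every hyperplane section spans the hyperplane. -/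
theorem exists_eq_smul_of_section {K : Type*} [Field K] [Finite K] {q : ℕ} (hq : IsPrimePow q)
    (hodd : Odd q) (hK : Nat.card K = q ^ 2) {n : ℕ} (hn : 2 ≤ n) {α β : K} (hα : α ≠ 0)
    (hβ : β ^ q ≠ β) {a b : Fin (n + 1 + 1) → K} (ha : a ≠ 0)
    (h : ∀ X, hypersurfaceForm q (n + 1) α β X = 0 → X ⬝ᵥ a = 0 → X ⬝ᵥ b = 0) :
    ∃ c : K, b = c • a := by
  obtain ⟨ι, hι⟩ := exists_sq_eq_neg_one hodd hK
  have h2 := two_ne_zero_of_odd_card hodd hK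
  have hinf := hypersurfaceForm_infinity_iff hq hK n hα β
  -- In each case `c` is chosen to make one coordinate of `b - c • a` vanish; the section then kills
  -- the others.
  have hred (c : K) (X) (hX : hypersurfaceForm q (n + 1) α β X = 0) (hXa : X ⬝ᵥ a = 0) :
      X ⬝ᵥ (b - c • a) = 0 := by
    rw [dotProduct_sub, dotProduct_smul, h X hX hXa, hXa, smul_zero, sub_zero]
  have hzero : coordVec 0 (0 : Fin n → K) 0 = 0 := by
    simpa using (smul_coordVec (0 : K) 0 (0 : Fin n → K) 0).symm
  suffices hs : ∃ c : K, b - c • a = 0 from hs.imp fun c hc => sub_eq_zero.1 hc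
  obtain ⟨a₀, a, s, rfl⟩ := exists_eq_coordVec a
  -- `s = 0` means that the hyperplane contains the vertex `(0, …, 0, 1)` of the cone at infinity;
  -- if also `a = 0`, it is the hyperplane at infinity.
  by_cases hs : s = 0
  · subst hs
    by_cases ha' : a = 0
    · subst ha'
      have ha₀ : a₀ ≠ 0 := by
        rintro rfl
        exact ha hzero
      refine ⟨b 0 / a₀, ?_⟩
      specialize hred (b 0 / a₀)
      have hb0 : (b - (b 0 / a₀) • coordVec a₀ (0 : Fin n → K) 0) 0 = 0 := by
        simp [ha₀]
      generalize b - (b 0 / a₀) • coordVec a₀ (0 : Fin n → K) 0 = d at hred hb0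
      obtain ⟨d₀, d, w, rfl⟩ := exists_eq_coordVec d
      rw [coordVec_zero] at hb0
      subst hb0
      have hw := hred (coordVec 0 0 1) ((hinf _ _).2 (by simp)) (by simp [coordVec_dotProduct])
      simp [coordVec_dotProduct] at hw
      subst hw
      have hd : d = 0 := eq_zero_of_isotropic_dotProduct hι h2 hn fun x hx => by
        simpa [coordVec_dotProduct] using
          hred (coordVec 0 x 0) ((hinf _ _).2 hx) (by simp [coordVec_dotProduct])
      rw [hd, hzero]
    · obtain ⟨k, hk⟩ := Function.ne_iff.1 ha'
      rw [Pi.zero_apply] at hk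
      refine ⟨b k.castSucc.succ / a k, ?_⟩
      specialize hred (b k.castSucc.succ / a k)
      have hbk : (b - (b k.castSucc.succ / a k) • coordVec a₀ a 0) k.castSucc.succ = 0 := by
        simp [hk]
      generalize b - (b k.castSucc.succ / a k) • coordVec a₀ a 0 = d at hred hbk
      obtain ⟨d₀, d, w, rfl⟩ := exists_eq_coordVec d
      rw [coordVec_castSucc_succ] at hbk
      -- The affine part of the hyperplane is a union of lines through the vertex, each carrying `q
      -- > 1` hypersurface points; two of them force `w = 0`.
      have hline (x : Fin n → K) (hx : a₀ + x ⬝ᵥ a = 0) : w = 0 ∧ d₀ + x ⬝ᵥ d = 0 := by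
        have hcard := ncard_last_coord hq hK n α β one_ne_zero x
        have hlt : 1 < {t : K | hypersurfaceForm q (n + 1) α β (coordVec 1 x t) = 0}.ncard := by
          rw [hcard]
          exact hq.one_lt
        obtain ⟨t, ht, t', ht', htt⟩ := (Set.one_lt_ncard (Set.toFinite _)).1 hlt
        have e := hred _ ht (by simp [coordVec_dotProduct, hx])
        have e' := hred _ ht' (by simp [coordVec_dotProduct, hx])
        rw [coordVec_dotProduct] at e e'
        have hw : w = 0 := by
          have : (t - t') * w = 0 := by linear_combination e - e'
          exact (mul_eq_zero.1 this).resolve_left (sub_ne_zero.2 htt)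
        refine ⟨hw, ?_⟩
        rw [hw] at e
        linear_combination e
      -- Any `y` is moved into the hyperplane by changing coordinate `k`, where `d` vanishes.
      have hall (y : Fin n → K) : w = 0 ∧ d₀ + y ⬝ᵥ d = 0 := by
        have e := hline (y + Pi.single k (-(a₀ + y ⬝ᵥ a) / a k)) (by
          rw [add_dotProduct, single_dotProduct]
          field_simp
          ring)
        rw [add_dotProduct, single_dotProduct, hbk, mul_zero, add_zero] at e
        exact e
      have hd₀ : d₀ = 0 := by simpa using (hall 0).2
      have hd : d = 0 := by
        ext i
        simpa [hd₀] using (hall (Pi.single i 1)).2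
      rw [hd₀, hd, (hall 0).1, hzero]
  · refine ⟨b (Fin.last (n + 1)) / s, ?_⟩
    specialize hred (b (Fin.last (n + 1)) / s)
    have hbl : (b - (b (Fin.last (n + 1)) / s) • coordVec a₀ a s) (Fin.last (n + 1)) = 0 := by
      simp [hs]
    generalize b - (b (Fin.last (n + 1)) / s) • coordVec a₀ a s = d at hred hbl
    obtain ⟨d₀, d, w, rfl⟩ := exists_eq_coordVec d
    rw [coordVec_last] at hbl
    subst hbl
    -- Away from the vertex, each isotropic `x` lifts to a point at infinity in the hyperplane; one
    -- affine point then settles `d₀`.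
    have hd : d = 0 := eq_zero_of_isotropic_dotProduct hι h2 hn fun x hx => by
      have e := hred (coordVec 0 x (-(x ⬝ᵥ a) / s)) ((hinf _ _).2 hx) (by
        rw [coordVec_dotProduct]
        field_simp
        ring)
      simpa [coordVec_dotProduct] using e
    subst hd
    obtain ⟨x, hx⟩ := exists_affine_point hq hodd hK hn hα hβ (-a₀ / s) ((-s⁻¹) • a)
    have e := hred _ hx (by
      rw [coordVec_dotProduct, dotProduct_smul, smul_eq_mul]
      field_simp
      ring)
    have hd₀ : d₀ = 0 := by simpa [coordVec_dotProduct] using e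
    rw [hd₀, hzero]

/-! ### Access sets and linear forms -/

theorem mem_iff_exists_vecMul_eq {K : Type*} [Field K] {k n : ℕ} {H : Matrix (Fin k) (Fin n) K}
    {C : Submodule K (Fin n → K)} (hH : IsGeneratorMatrix H C) (w : Fin n → K) :
    w ∈ C ↔ ∃ u, Matrix.vecMul u H = w := by
  rw [← hH.2, ← range_vecMulLinear]
  rfl

theorem mem_projectiveCode_iff {K : Type*} [Field K] {n s : ℕ} (v : Fin n → Fin s → K)
    (w : Fin n → K) : w ∈ projectiveCode v ↔ ∃ a : Fin s → K, ∀ i, w i = v i ⬝ᵥ a := by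
  rw [projectiveCode, ← range_vecMulLinear, LinearMap.mem_range]
  refine exists_congr fun a => ?_
  rw [funext_iff]
  refine forall_congr' fun i => ?_
  rw [Matrix.vecMulLinear_apply, Matrix.vecMul_transpose, eq_comm]
  rfl

/-- A set of participants is an access set if and only if its shares never vanish while the secret
does not. -/
theorem isAccessSet_iff_forall {K : Type*} [Field K] {k m : ℕ} (H : Matrix (Fin k) (Fin (m + 1)) K)
    (A : Finset (Fin m)) :
    IsAccessSet H A ↔ ∀ u, (∀ i ∈ A, share H u i = 0) → secret H u = 0 := by
  constructor
  · rintro ⟨f, hf⟩ u hu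
    have h0 : secret H 0 = 0 := by simp [secret]
    rw [← hf u, ← h0, ← hf 0]
    congr 1
    ext i
    rw [hu i i.2]
    simp [share]
  · intro h
    have hdiff (u u' : Fin k → K) (huu : ∀ i ∈ A, share H u i = share H u' i) :
        secret H u = secret H u' := by
      have h0 := h (u - u') fun i hi => by
        have := huu i hi
        simp only [share, Matrix.sub_vecMul, Pi.sub_apply] at this ⊢
        rw [this, sub_self]
      simp only [secret, Matrix.sub_vecMul, Pi.sub_apply] at h0 ⊢
      exact sub_eq_zero.1 h0
    classical
    -- By `hdiff` any dealer's vector with the given shares yields the right secret; `0` is a dummy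
    -- for impossible shares.
    refine ⟨fun y => if hy : ∃ u, (fun i : A => share H u i) = y then secret H hy.choose else 0,
      fun u => ?_⟩
    have hy : ∃ u', (fun i : A => share H u' i) = fun i : A => share H u i := ⟨u, rfl⟩
    refine (dif_pos hy).trans ?_
    exact hdiff _ _ fun i hi => congrFun hy.choose_spec ⟨i, hi⟩

/-- The access sets are given by the codewords that do not vanish at the first position. -/
theorem isAccessSet_iff_exists {K : Type*} [Field K] {k m s : ℕ} (v : Fin (m + 1) → Fin s → K)
    {H : Matrix (Fin k) (Fin (m + 1)) K} (hH : IsGeneratorMatrix H (dualCode (projectiveCode v)))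
    (A : Finset (Fin m)) :
    IsAccessSet H A ↔ ∃ a, v 0 ⬝ᵥ a = 1 ∧ ∀ j ∉ A, v j.succ ⬝ᵥ a = 0 := by
  have hword : IsAccessSet H A ↔
      ∀ w ∈ dualCode (projectiveCode v), (∀ i ∈ A, w i.succ = 0) → w 0 = 0 := by
    rw [isAccessSet_iff_forall]
    constructor
    · intro h w hw
      obtain ⟨u, rfl⟩ := (mem_iff_exists_vecMul_eq hH w).1 hw
      exact h u
    · intro h u
      exact h _ ((mem_iff_exists_vecMul_eq hH _).2 ⟨u, rfl⟩)
  rw [hword]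
  constructor
  · intro h
    set E : Submodule K (Fin (m + 1) → K) :=
      Submodule.span K ((fun i : Fin m => Pi.single i.succ (1 : K)) '' A) with hE
    -- Otherwise a functional separating this unit vector from the sum would be a dual codeword
    -- vanishing on `A` but not at position `0`.
    have hmem : (Pi.single 0 1 : Fin (m + 1) → K) ∈ projectiveCode v ⊔ E := by
      by_contra hnot
      obtain ⟨φ, hφ, hle⟩ := Submodule.exists_le_ker_of_notMem hnot
      have hφw (c : Fin (m + 1) → K) : (fun i => φ (Pi.single i 1)) ⬝ᵥ c = φ c := by
        conv_rhs => rw [← Finset.univ_sum_single c]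
        rw [map_sum, dotProduct]
        refine Finset.sum_congr rfl fun i _ => ?_
        rw [mul_comm, ← smul_eq_mul, ← map_smul, ← Pi.single_smul, smul_eq_mul, mul_one]
      refine hφ (h (fun i => φ (Pi.single i 1)) (fun c hc => ?_) fun i hi => ?_)
      · rw [hφw]
        exact hle (Submodule.mem_sup_left hc)
      · exact hle (Submodule.mem_sup_right (Submodule.subset_span ⟨i, hi, rfl⟩))
    obtain ⟨c, hc, e, he, hce⟩ := Submodule.mem_sup.1 hmem
    obtain ⟨a, ha⟩ := (mem_projectiveCode_iff v c).1 hc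
    have hzero (j : Fin (m + 1)) (hj : ∀ i ∈ A, i.succ ≠ j) : e j = 0 := by
      have hle : E ≤ LinearMap.ker (LinearMap.proj (R := K) (φ := fun _ : Fin (m + 1) => K) j) := by
        rw [hE, Submodule.span_le]
        rintro _ ⟨i, hi, rfl⟩
        simp [(hj i hi).symm]
      exact hle he
    refine ⟨a, ?_, fun j hj => ?_⟩
    · have := congrFun hce 0
      rw [Pi.add_apply, hzero 0 fun i _ => Fin.succ_ne_zero i, add_zero, Pi.single_eq_same] at this
      rw [← ha, this]
    · have := congrFun hce j.succ
      rw [Pi.add_apply, hzero j.succ fun i hi hij => hj (Fin.succ_injective _ hij ▸ hi), add_zero,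
        Pi.single_eq_of_ne (Fin.succ_ne_zero j)] at this
      rw [← ha, this]
  · rintro ⟨a, ha0, haj⟩ w hw hwA
    have h := hw (fun i => v i ⬝ᵥ a) ((mem_projectiveCode_iff v _).2 ⟨a, fun _ => rfl⟩)
    rw [dotProduct, Fin.sum_univ_succ, ha0, mul_one, Finset.sum_eq_zero, add_zero] at h
    · exact h
    · intro j _
      by_cases hj : j ∈ A
      · rw [hwA j hj, zero_mul]
      · rw [haj j hj, mul_zero]

/-- When every hyperplane section of the projective system spans the hyperplane, the minimal
access sets are the complements of the hyperplanes that miss the first point. -/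
theorem bijOn_accessStructure {K : Type*} [Field K] [DecidableEq K] {k m s : ℕ}
    (v : Fin (m + 1) → Fin s → K)
    {H : Matrix (Fin k) (Fin (m + 1)) K} (hH : IsGeneratorMatrix H (dualCode (projectiveCode v)))
    (hv : ∀ a b : Fin s → K, a ≠ 0 → (∀ i, v i ⬝ᵥ a = 0 → v i ⬝ᵥ b = 0) → ∃ c : K, b = c • a) :
    Set.BijOn (fun a => Finset.univ.filter fun j : Fin m => v j.succ ⬝ᵥ a ≠ 0)
      {a | v 0 ⬝ᵥ a = 1} (accessStructure H) := by
  -- Nested zero sets make the forms proportional, and the common value 1 at `v 0` makes them equal.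
  have huniq (a b : Fin s → K) (ha : v 0 ⬝ᵥ a = 1) (hb : v 0 ⬝ᵥ b = 1)
      (hab : ∀ j : Fin m, v j.succ ⬝ᵥ a = 0 → v j.succ ⬝ᵥ b = 0) : b = a := by
    have ha0 : a ≠ 0 := by
      rintro rfl
      simp at ha
    obtain ⟨c, rfl⟩ := hv a b ha0 fun i => by
      refine Fin.cases (fun h => ?_) hab i
      rw [ha] at h
      exact absurd h one_ne_zero
    rw [dotProduct_smul, ha, smul_eq_mul, mul_one] at hb
    rw [hb, one_smul]
  have hacc (a : Fin s → K) (ha : v 0 ⬝ᵥ a = 1) :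
      IsAccessSet H (Finset.univ.filter fun j : Fin m => v j.succ ⬝ᵥ a ≠ 0) :=
    (isAccessSet_iff_exists v hH _).2 ⟨a, ha, fun j hj => by simpa using hj⟩
  refine ⟨fun a ha => ⟨hacc a ha, fun A' hA' hA'acc => ?_⟩, fun a ha b hb hab => ?_, ?_⟩
  · obtain ⟨b, hb, hbA⟩ := (isAccessSet_iff_exists v hH _).1 hA'acc
    have hba : b = a := huniq a b ha hb fun j hj => hbA j fun hjA => by
      have := hA'.1 hjA
      simp [hj] at this
    subst hba
    refine hA'.2 fun j hj => ?_
    by_contra hjA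
    simp [hbA j hjA] at hj
  · refine (huniq a b ha hb fun j hj => ?_).symm
    have := Finset.ext_iff.1 hab j
    simpa [hj] using this
  · rintro A ⟨hA, hmin⟩
    obtain ⟨a, ha, haA⟩ := (isAccessSet_iff_exists v hH _).1 hA
    refine ⟨a, ha, ?_⟩
    have hsub : (Finset.univ.filter fun j : Fin m => v j.succ ⬝ᵥ a ≠ 0) ⊆ A := by
      intro j hj
      by_contra hjA
      simp [haA j hjA] at hj
    by_contra hne
    exact hmin _ (Finset.ssubset_iff_subset_ne.2 ⟨hsub, hne⟩) (hacc a ha)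

/-! ### Counting linear forms and conclusion -/

theorem ncard_fibre_mul_card {K V W : Type*} [Field K] [AddCommGroup V] [Module K V]
    [AddCommGroup W] [Module K W] [Finite V] (f : V →ₗ[K] W) (hf : Function.Surjective f) (w : W) :
    {x | f x = w}.ncard * Nat.card W = Nat.card V := by
  obtain ⟨x₀, rfl⟩ := hf w
  have himg : {x | f x = f x₀} = (fun y => x₀ + y) '' (f.toAddMonoidHom.ker : Set V) := by
    ext x
    simp only [Set.mem_ofPred_eq, Set.mem_image, SetLike.mem_coe, AddMonoidHom.mem_ker,
      LinearMap.toAddMonoidHom_coe]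
    constructor
    · intro h
      exact ⟨x - x₀, by rw [map_sub, h, sub_self], by abel⟩
    · rintro ⟨y, hy, rfl⟩
      rw [map_add, hy, add_zero]
  have hrange : Nat.card f.toAddMonoidHom.range = Nat.card W := by
    rw [AddMonoidHom.range_eq_top.2 hf]
    exact Nat.card_congr AddSubgroup.topEquiv.toEquiv
  rw [himg, Set.ncard_image_of_injective _ (add_right_injective x₀), ← hrange,
    ← AddSubgroup.index_ker]
  exact AddSubgroup.card_mul_index _

theorem ncard_dotProduct_eq_one {K : Type*} [Field K] [Finite K] {r : ℕ} {x : Fin (r + 1) → K}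
    (hx : x ≠ 0) : {a | x ⬝ᵥ a = 1}.ncard = Nat.card K ^ r := by
  have hsurj : Function.Surjective (dotProductBilin K K x) := by
    refine LinearMap.surjective (f := dotProductBilin K K x) fun h => hx (dotProduct_eq_zero x fun a => ?_)
    exact LinearMap.congr_fun h a
  have h := ncard_fibre_mul_card _ hsurj 1
  have h2 : Nat.card (Fin (r + 1) → K) = Nat.card K ^ r * Nat.card K := by
    rw [Nat.card_fun, Nat.card_fin, pow_succ]
  rw [h2] at h
  exact Nat.eq_of_mul_eq_mul_right Nat.card_pos h

/-- Independence makes `a ↦ (x ⬝ᵥ a, y ⬝ᵥ a)` surjective, so the fibre over `(1, 0)` can be counted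
and removed from `x ⬝ᵥ a = 1`. -/
theorem ncard_dotProduct_eq_one_and_ne_zero {K : Type*} [Field K] [Finite K] {r : ℕ}
    {x y : Fin (r + 1 + 1) → K} (hxy : LinearIndependent K ![x, y]) :
    {a | x ⬝ᵥ a = 1 ∧ y ⬝ᵥ a ≠ 0}.ncard = (Nat.card K - 1) * Nat.card K ^ r := by
  have hx : x ≠ 0 := hxy.ne_zero 0
  have hsurj : Function.Surjective ((dotProductBilin K K x).prod (dotProductBilin K K y)) := by
    rw [← LinearMap.range_eq_top]
    by_contra hne
    -- A nonzero functional on `K × K` killing the image is a linear relation between `x` and `y`.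
    obtain ⟨φ, hφ0, hφ⟩ := Submodule.exists_le_ker_of_lt_top _ (lt_top_iff_ne_top.2 hne)
    have hsum (w z : K) : φ (w, z) = φ (1, 0) * w + φ (0, 1) * z := by
      have : ((w, z) : K × K) = w • (1, 0) + z • (0, 1) := by simp
      rw [this, map_add, map_smul, map_smul, smul_eq_mul, smul_eq_mul, mul_comm w, mul_comm z]
    have hrel : φ (1, 0) • x + φ (0, 1) • y = 0 := by
      refine dotProduct_eq_zero _ fun a => ?_
      rw [add_dotProduct, smul_dotProduct, smul_dotProduct, smul_eq_mul, smul_eq_mul, ← hsum]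
      exact hφ ⟨a, rfl⟩
    obtain ⟨e1, e2⟩ := LinearIndependent.pair_iff.1 hxy _ _ hrel
    refine hφ0 (LinearMap.ext fun p => ?_)
    rw [← Prod.mk.eta (p := p), hsum, e1, e2]
    simp
  have h := ncard_fibre_mul_card _ hsurj (1, 0)
  have h2 : Nat.card (Fin (r + 1 + 1) → K) = Nat.card K ^ r * Nat.card (K × K) := by
    rw [Nat.card_fun, Nat.card_fin, Nat.card_prod, pow_succ, pow_succ, mul_assoc]
  rw [h2] at h
  have h3 := Nat.eq_of_mul_eq_mul_right Nat.card_pos h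
  have hset : {a | x ⬝ᵥ a = 1 ∧ y ⬝ᵥ a ≠ 0} = {a | x ⬝ᵥ a = 1} \
      {a | (dotProductBilin K K x).prod (dotProductBilin K K y) a = (1, 0)} := by
    ext a
    have hpair : (dotProductBilin K K x).prod (dotProductBilin K K y) a = (1, 0) ↔
        x ⬝ᵥ a = 1 ∧ y ⬝ᵥ a = 0 := Prod.mk_inj
    simp only [Set.mem_ofPred_eq, Set.mem_sdiff, hpair]
    tauto
  rw [hset, Set.ncard_sdiff _ (Set.toFinite _), h3, ncard_dotProduct_eq_one hx, pow_succ,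
    Nat.sub_mul, one_mul, mul_comm]
  intro a ha
  exact congrArg Prod.fst (show (x ⬝ᵥ a, y ⬝ᵥ a) = (1, 0) from ha)

theorem theorem6p4 {K : Type*} [Field K] [Finite K] (q r : ℕ) (hq : IsPrimePow q)
    (hodd : Odd q) (hK : Nat.card K = q ^ 2) (hr : 3 ≤ r) (α β : K)
    (hαβ : AdmissibleCoeffs q r α β) :
    ((hypersurface q r α β).ncard : ℚ) = numParticipants q r + 1 ∧
    ∀ (m : ℕ) (P : Fin (m + 1) ≃ hypersurface q r α β)
      (v : Fin (m + 1) → Fin (r + 1) → K) (hv : ∀ i, v i ≠ 0)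
      (_ : ∀ i, Projectivization.mk K (v i) (hv i) = (P i : Projectivization K _))
      (k : ℕ) (H : Matrix (Fin k) (Fin (m + 1)) K)
      (_ : IsGeneratorMatrix H (dualCode (projectiveCode v))),
      (m : ℚ) = numParticipants q r ∧
      (accessStructure H).ncard = q ^ (2 * r) ∧
      (∀ i : Fin m,
        {A ∈ accessStructure H | i ∈ A}.ncard = (q ^ 2 - 1) * q ^ (2 * (r - 1))) ∧
      IsDemocratic H := by
  classical
  obtain ⟨hα, hβ, -⟩ := hαβ
  have hN := ncard_hypersurface hq hodd hK (r := r) (by omega) hα β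
  refine ⟨hN, fun m P v hv hvP k H hH => ?_⟩
  obtain ⟨n, rfl⟩ := Nat.exists_eq_add_of_le' (show 1 ≤ r by omega)
  have hm : (m : ℚ) = numParticipants q (n + 1) := by
    have hcard : (hypersurface q (n + 1) α β).ncard = m + 1 :=
      (Nat.card_congr P.symm).trans (Nat.card_fin _)
    rw [hcard] at hN
    push_cast at hN
    linarith
  have hsec (a b : Fin (n + 1 + 1) → K) (ha : a ≠ 0)
      (hab : ∀ i, v i ⬝ᵥ a = 0 → v i ⬝ᵥ b = 0) : ∃ c : K, b = c • a := by
    refine exists_eq_smul_of_section hq hodd hK (by omega) hα hβ ha fun X hX hXa => ?_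
    by_cases hX0 : X = 0
    · rw [hX0, zero_dotProduct]
    · obtain ⟨i, hi⟩ := P.surjective
        ⟨Projectivization.mk K X hX0, (mk_mem_hypersurface_iff hq.one_lt.le _ α β X hX0).2 hX⟩
      have hmk : Projectivization.mk K X hX0 = Projectivization.mk K (v i) (hv i) := by
        rw [hvP, hi]
      obtain ⟨c, rfl⟩ := (Projectivization.mk_eq_mk_iff K _ _ _ _).1 hmk
      rw [Units.smul_def, smul_dotProduct, smul_eq_mul, mul_eq_zero, or_iff_right c.ne_zero] at hXa
      rw [Units.smul_def, smul_dotProduct, hab i hXa, smul_zero]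
  have hbij := bijOn_accessStructure v hH hsec
  have hmem (i : Fin m) : {A ∈ accessStructure H | i ∈ A}.ncard =
      (q ^ 2 - 1) * q ^ (2 * (n + 1 - 1)) := by
    have himg : {A ∈ accessStructure H | i ∈ A} =
        (fun a => Finset.univ.filter fun j : Fin m => v j.succ ⬝ᵥ a ≠ 0) ''
          {a | v 0 ⬝ᵥ a = 1 ∧ v i.succ ⬝ᵥ a ≠ 0} := by
      ext A
      simp only [← hbij.image_eq, Set.mem_image, Set.mem_ofPred_eq]
      constructor
      · rintro ⟨⟨a, ha, rfl⟩, hi⟩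
        exact ⟨a, ⟨ha, (Finset.mem_filter.1 hi).2⟩, rfl⟩
      · rintro ⟨a, ⟨ha, hi⟩, rfl⟩
        exact ⟨⟨a, ha, rfl⟩, Finset.mem_filter.2 ⟨Finset.mem_univ _, hi⟩⟩
    rw [himg, (hbij.injOn.mono fun a ha => ha.1).ncard_image,
      ncard_dotProduct_eq_one_and_ne_zero, hK, pow_mul, Nat.add_sub_cancel]
    -- Proportional representatives would give the same projective point, against injectivity of
    -- `P`.
    refine (LinearIndependent.pair_iff' (hv 0)).2 fun c hc => ?_
    have hc0 : c ≠ 0 := by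
      rintro rfl
      exact hv i.succ (by rw [← hc, zero_smul])
    have heq : P i.succ = P 0 := Subtype.ext (by
      rw [← hvP, ← hvP, Projectivization.mk_eq_mk_iff']
      exact ⟨c, hc⟩)
    exact Fin.succ_ne_zero i (P.injective heq)
  refine ⟨hm, ?_, hmem, fun i j => by rw [hmem, hmem]⟩
  rw [← hbij.image_eq, hbij.injOn.ncard_image, ncard_dotProduct_eq_one (hv 0), hK,
    pow_mul]
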